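/- Let $N\ge1$ be an integer, let $q\in\mathbb C$ with $0<|q|<1$, and fix any logarithm $w$ of $q$ (so $e^{w}=q$); for rational $s$ put $q^{s}=e^{sw}$. Write $(q)_k=\prod_{i=1}^{k}(1-q^i)$ and $(q)_\infty=\prod_{i\ge1}(1-q^i)$. Let $C$ be the Cartan matrix of the Lie algebra $A_{N-1}$, i.e. the $(N-1)\times(N-1)$ matrix with entries $C_{ab}=2\delta_{a,b}-\delta_{a,b-1}-\delta_{a,b+1}$. Then $$\frac{1}{(q)_\infty}\sum_{j=-\infty}^{\infty}(-1)^j q^{((1+2/N)j+1)j/2}\sum_{\substack{\vec\eta\in\mathbb Z_{\ge0}^{N-1}\\ j/N-(C^{-1}\vec\eta)_1\in\mathbb Z}}\frac{q^{\vec\eta\,C^{-1}\vec\eta}}{(q)_{\eta_1}\cdots(q)_{\eta_{N-1}}}=1,$$ where the infinite product, the inner sum for every $j\in\mathbb Z$, and the outer sum over $j$ all converge absolutely. For $N=1$ there is only the empty vector $\vec\eta$, and $(C^{-1}\vec\eta)_1$ is read as $0$, so that the inner sum equals $1$. -/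

import Mathlib

open scoped Matrix

noncomputable section

namespace GenEuler

/-- The `q`-shifted factorial `(a)_k = (1 - a)(1 - aq) ⋯ (1 - aq^(k-1))` (base `q`). -/
def qPoch (a q : ℂ) (k : ℕ) : ℂ := ∏ i ∈ Finset.range k, (1 - a * q ^ i)

/-- The infinite `q`-shifted factorial `(a)_∞ = ∏_{i ≥ 0} (1 - aq^i)` (base `q`). -/
def qPochInf (a q : ℂ) : ℂ := ∏' i : ℕ, (1 - a * q ^ i)

/-- The Cartan matrix `C` of `A_{N-1}`, with rational entries. -/
def cartan (N : ℕ) : Matrix (Fin (N - 1)) (Fin (N - 1)) ℚ :=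
  (CartanMatrix.A (N - 1)).map (fun z : ℤ => (z : ℚ))

/-- The vector with entries `(e_l)_j = δ_{l,j}`, where `j = 1, …, N-1` (coordinate `j` is stored
at the index `j - 1` of `Fin (N - 1)`).  If `N = 1` it is the empty vector. -/
def unitVec (N l : ℕ) : Fin (N - 1) → ℚ := fun j => if (j : ℕ) + 1 = l then 1 else 0

/-- A vector of non-negative integers, with its entries viewed as rational numbers. -/
def ratVec {N : ℕ} (η : Fin (N - 1) → ℕ) : Fin (N - 1) → ℚ := fun j => (η j : ℚ)

/-- The first entry `(C⁻¹ η)_1 = e_1 C⁻¹ η`; the empty sum `0` if `N = 1`. -/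
def firstEntry {N : ℕ} (η : Fin (N - 1) → ℕ) : ℚ :=
  unitVec N 1 ⬝ᵥ ((cartan N)⁻¹ *ᵥ ratVec η)

/-- The quadratic form `η C⁻¹ η`. -/
def quadForm {N : ℕ} (η : Fin (N - 1) → ℕ) : ℚ :=
  ratVec η ⬝ᵥ ((cartan N)⁻¹ *ᵥ ratVec η)

/-- The summation range: all `η ∈ ℕ^(N-1)` with `j / N - (C⁻¹ η)_1 ∈ ℤ`. -/
def Admissible (N : ℕ) (j : ℤ) : Set (Fin (N - 1) → ℕ) :=
  {η | ∃ m : ℤ, (j : ℚ) / (N : ℚ) - firstEntry η = (m : ℚ)}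

/-- The power `q ^ s` with rational exponent, for the choice `w` of a logarithm of `q`. -/
def qPow (w : ℂ) (s : ℚ) : ℂ := Complex.exp ((s : ℂ) * w)

/-- The summand `q ^ (η C⁻¹ η) / ((q)_{η_1} ⋯ (q)_{η_{N-1}})`. -/
def innerTerm {N : ℕ} (q w : ℂ) (η : Fin (N - 1) → ℕ) : ℂ :=
  qPow w (quadForm η) / ∏ i, qPoch q q (η i)

/-- The summand `(-1) ^ j q ^ (((1 + 2/N) j + 1) j / 2) ∑_η …` of the sum over `j`. -/
def outerTerm (N : ℕ) (q w : ℂ) (j : ℤ) : ℂ :=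
  (-1 : ℂ) ^ j * qPow w (((1 + 2 / (N : ℚ)) * (j : ℚ) + 1) * (j : ℚ) / 2) *
    ∑' η : Admissible N j, innerTerm q w (η : Fin (N - 1) → ℕ)

end GenEuler

end

/-!
Put `θ(z) = ∑_k (-1)^k q^(k(k-1)/2) z^k`, and let `F(z)` be the sum of
`z^(∑ v_i) q^(∑ v_i²) / ∏ (q)_{v_i - v_{i+1}}` over all decreasing chains `v_0 ≥ ⋯ ≥ v_{N-1}` of
integers. A bilateral Bailey lemma expresses the Bailey sum at level `k + 1` through those at level
`k`. The Bailey sum at level `0` does not depend on its index `L`, because its increments telescope;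
letting `L → ∞`, it equals `θ(z) / (q)_∞`. Iterating the lemma `N` times and letting `L → ∞` once
more gives
`θ(z) F(z) = (q)_∞ ∑_j z^((N+2)j) q^((N+2)j² - j) (1 - z q^(2j))`,
and the theorem is the comparison of the coefficients of `z`, both sides being Laurent series on the
unit circle.

To pass from chains to vectors `η`, write `C = D Dᵀ`, where the rows of `D` are the simple roots
`e_l - e_{l+1}` in `ℚ^N`. If `η = D v` is the vector of differences of `v`, then `Dᵀ C⁻¹ η` is `v`
minus its mean, which gives `(C⁻¹ η)_1 = v_0 - (∑ v_i) / N` and `η C⁻¹ η = ∑ v_i² - (∑ v_i)² / N`.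
So the admissible `η` for `j` correspond to the chains with sum `-j`.
-/

open Filter Topology Finset.HasAntidiagonal

namespace GenEuler

section GaussianBounded

/-- `f` decays (or, for `a < 0`, grows) like the Gaussian `exp (-a j ^ 2)` along the integers, up to
a factor exponential in `|j|`. -/
def GaussianBounded {E : Type*} [Norm E] (a : ℝ) (f : ℤ → E) : Prop :=
  ∃ b : ℝ, ∀ j : ℤ, ‖f j‖ ≤ Real.exp (b * (1 + |(j : ℝ)|) - a * (j : ℝ) ^ 2)

theorem summable_exp_abs_sub_sq {a : ℝ} (ha : 0 < a) (b : ℝ) :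
    Summable fun j : ℤ => Real.exp (b * (1 + |(j : ℝ)|) - a * (j : ℝ) ^ 2) := by
  have h := (summable_pow_mul_jacobiTheta₂_term_bound (b / (2 * Real.pi))
    (div_pos ha Real.pi_pos) 0).mul_left (Real.exp b)
  refine h.congr fun j => ?_
  rw [pow_zero, one_mul, Int.cast_abs, ← Real.exp_add]
  congr 1
  field_simp
  ring

theorem mul_add_sq_le {a b c : ℝ} (ha : 0 < a) (hb : 0 < b) (hc : 0 ≤ c) (x y : ℝ) :
    c * (x + y) ^ 2 ≤ c * (a + b) / (a * b) * (a * x ^ 2 + b * y ^ 2) := by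
  have hsq : a * b * (x + y) ^ 2 ≤ (a + b) * (a * x ^ 2 + b * y ^ 2) := by
    linarith [sq_nonneg (a * x - b * y)]
  calc c * (x + y) ^ 2 = c / (a * b) * (a * b * (x + y) ^ 2) := by field_simp
    _ ≤ c / (a * b) * ((a + b) * (a * x ^ 2 + b * y ^ 2)) := by gcongr
    _ = _ := by ring

namespace GaussianBounded

variable {E F G : Type*} {a b c : ℝ}

theorem of_norm_le [Norm E] {f : ℤ → E} {C : ℝ} (hf : ∀ j, ‖f j‖ ≤ C) : GaussianBounded 0 f := by
  refine ⟨|C|, fun j => (hf j).trans ?_⟩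
  calc C ≤ |C| * (1 + |(j : ℝ)|) := (le_abs_self C).trans
        (le_mul_of_one_le_right (abs_nonneg C) (le_add_of_nonneg_right (abs_nonneg _)))
    _ ≤ Real.exp (|C| * (1 + |(j : ℝ)|) - 0 * (j : ℝ) ^ 2) := by
        rw [zero_mul, sub_zero]
        exact (le_add_of_nonneg_right zero_le_one).trans (Real.add_one_le_exp _)

theorem norm [SeminormedAddCommGroup E] {f : ℤ → E} (hf : GaussianBounded a f) :
    GaussianBounded a fun j => ‖f j‖ :=
  let ⟨b, hb⟩ := hf
  ⟨b, fun j => (norm_norm (f j)).trans_le (hb j)⟩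

theorem mul [NonUnitalSeminormedRing E] {f g : ℤ → E} (hf : GaussianBounded a f)
    (hg : GaussianBounded b g) : GaussianBounded (a + b) fun j => f j * g j := by
  obtain ⟨bf, hf⟩ := hf
  obtain ⟨bg, hg⟩ := hg
  refine ⟨bf + bg, fun j => (norm_mul_le_of_le (hf j) (hg j)).trans_eq ?_⟩
  rw [← Real.exp_add]
  ring_nf

theorem const_mul [NonUnitalSeminormedRing E] {f : ℤ → E} (hf : GaussianBounded a f) (x : E) :
    GaussianBounded a fun j => x * f j := by
  simpa only [zero_add] using (of_norm_le fun _ => le_rfl : GaussianBounded 0 fun _ => x).mul hf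

theorem sub [SeminormedAddGroup E] {f g : ℤ → E} (hf : GaussianBounded a f)
    (hg : GaussianBounded a g) : GaussianBounded a fun j => f j - g j := by
  obtain ⟨bf, hf⟩ := hf
  obtain ⟨bg, hg⟩ := hg
  refine ⟨max bf bg + 1, fun j => (norm_sub_le_of_le (hf j) (hg j)).trans ?_⟩
  have : 0 ≤ 1 + |(j : ℝ)| := by positivity
  have le_M : ∀ {b'}, b' ≤ max bf bg → Real.exp (b' * (1 + |(j : ℝ)|) - a * (j : ℝ) ^ 2) ≤
      Real.exp (max bf bg * (1 + |(j : ℝ)|) - a * (j : ℝ) ^ 2) := fun hb' => by gcongr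
  set M := Real.exp (max bf bg * (1 + |(j : ℝ)|) - a * (j : ℝ) ^ 2)
  calc _ ≤ M + M := add_le_add (le_M (le_max_left bf bg)) (le_M (le_max_right bf bg))
    _ = M * (1 + 1) := by ring
    _ ≤ M * Real.exp (1 + |(j : ℝ)|) := by
        gcongr
        linarith [Real.add_one_le_exp (1 + |(j : ℝ)|), abs_nonneg (j : ℝ)]
    _ = _ := by rw [← Real.exp_add]; ring_nf

theorem summable [NormedAddCommGroup E] [CompleteSpace E] {f : ℤ → E} (hf : GaussianBounded a f)
    (ha : 0 < a) : Summable f :=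
  let ⟨b, hb⟩ := hf
  .of_norm_bounded (summable_exp_abs_sub_sq ha b) hb

theorem zpow [NormedDivisionRing E] {z : E} (hz : z ≠ 0) :
    GaussianBounded 0 fun j : ℤ => z ^ j := by
  refine ⟨|Real.log ‖z‖|, fun j => ?_⟩
  rw [norm_zpow, ← Real.rpow_intCast, Real.rpow_def_of_pos (norm_pos_iff.mpr hz), zero_mul,
    sub_zero]
  refine Real.exp_le_exp.mpr ?_
  calc Real.log ‖z‖ * j ≤ |Real.log ‖z‖| * |(j : ℝ)| := by rw [← abs_mul]; exact le_abs_self _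
    _ ≤ |Real.log ‖z‖| * (1 + |(j : ℝ)|) := by gcongr; linarith

theorem zpow_sq [NormedDivisionRing E] {q : E} (hq : q ≠ 0) :
    GaussianBounded (-Real.log ‖q‖) fun j : ℤ => q ^ (j ^ 2) := by
  refine ⟨0, fun j => ?_⟩
  rw [norm_zpow, ← Real.rpow_intCast, Real.rpow_def_of_pos (norm_pos_iff.mpr hq)]
  push_cast
  ring_nf
  rfl

theorem zpow_mul_zpow_quadratic [NormedField E] {z q : E} (hz : z ≠ 0) (hq : q ≠ 0) (k c d : ℤ) :
    GaussianBounded (-(c * Real.log ‖q‖)) fun j : ℤ => z ^ (k * j) * q ^ (c * j ^ 2 + d * j) := by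
  have h := ((zpow (zpow_ne_zero k hz)).mul (zpow_sq (zpow_ne_zero c hq))).mul
    (zpow (zpow_ne_zero d hq))
  rw [zero_add, add_zero, norm_zpow, Real.log_zpow] at h
  refine cast (congrArg _ (funext fun j => ?_)) h
  rw [zpow_add₀ hq, zpow_mul, zpow_mul, zpow_mul, mul_assoc]

theorem summable_mul_mul_add [SeminormedAddGroup E] [SeminormedAddGroup F]
    [SeminormedAddGroup G] {f : ℤ → E} {g : ℤ → F} {h : ℤ → G}
    (hf : GaussianBounded a f) (hg : GaussianBounded b g) (hh : GaussianBounded (-c) h)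
    (ha : 0 < a) (hb : 0 < b) (hc : 0 ≤ c) (habc : c * (a + b) < a * b) :
    Summable fun p : ℤ × ℤ => ‖f p.1‖ * ‖g p.2‖ * ‖h (p.1 + p.2)‖ := by
  obtain ⟨bf, hf⟩ := hf
  obtain ⟨bg, hg⟩ := hg
  obtain ⟨bh, hh⟩ := hh
  set u := c * (a + b) / (a * b)
  have hu : 0 < 1 - u := sub_pos.mpr ((div_lt_one (by positivity)).mpr habc)
  have hsum := (summable_exp_abs_sub_sq (mul_pos hu ha) (bf + |bh|)).mul_of_nonneg
    (summable_exp_abs_sub_sq (mul_pos hu hb) (bg + |bh|))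
    (fun _ => Real.exp_nonneg _) fun _ => Real.exp_nonneg _
  refine hsum.of_nonneg_of_le (fun _ => by positivity) fun ⟨j, r⟩ => ?_
  have cross := mul_add_sq_le ha hb hc (j : ℝ) r
  have linear : bh * (1 + |(j : ℝ) + r|) ≤ |bh| * (1 + |(j : ℝ)|) + |bh| * (1 + |(r : ℝ)|) :=
    calc bh * (1 + |(j : ℝ) + r|) ≤ |bh| * ((1 + |(j : ℝ)|) + (1 + |(r : ℝ)|)) := by
          refine mul_le_mul (le_abs_self bh) ?_ (by positivity) (abs_nonneg bh)
          linarith [abs_add_le (j : ℝ) r]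
      _ = _ := mul_add _ _ _
  calc ‖f j‖ * ‖g r‖ * ‖h (j + r)‖
      ≤ Real.exp (bf * (1 + |(j : ℝ)|) - a * (j : ℝ) ^ 2) *
          Real.exp (bg * (1 + |(r : ℝ)|) - b * (r : ℝ) ^ 2) *
          Real.exp (bh * (1 + |(↑(j + r) : ℝ)|) - -c * (↑(j + r) : ℝ) ^ 2) := by
        gcongr
        exacts [hf j, hg r, hh (j + r)]
    _ ≤ _ := by
        rw [← Real.exp_add, ← Real.exp_add, ← Real.exp_add, Real.exp_le_exp]
        push_cast
        linarith

end GaussianBounded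

end GaussianBounded

section QPochhammer

variable {q : ℂ}

theorem summable_norm_neg_mul_pow (hq : ‖q‖ < 1) (x : ℂ) :
    Summable fun i : ℕ => ‖-(x * q ^ i)‖ := by
  simpa only [norm_neg, norm_mul, norm_pow] using
    (summable_geometric_of_lt_one (norm_nonneg q) hq).mul_left ‖x‖

theorem multipliable_one_sub_mul_pow (hq : ‖q‖ < 1) (x : ℂ) :
    Multipliable fun i : ℕ => 1 - x * q ^ i := by
  simpa only [sub_eq_add_neg] using
    multipliable_one_add_of_summable (summable_norm_neg_mul_pow hq x)

theorem tendsto_qPoch (hq : ‖q‖ < 1) (x : ℂ) :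
    Tendsto (qPoch x q) atTop (𝓝 (qPochInf x q)) :=
  (multipliable_one_sub_mul_pow hq x).hasProd.tendsto_prod_nat

theorem qPochInf_eq_one_sub_mul (hq : ‖q‖ < 1) (x : ℂ) :
    qPochInf x q = (1 - x) * qPochInf (x * q) q := by
  have shift : (fun i : ℕ => 1 - x * q * q ^ i) = fun i => 1 - x * q ^ (i + 1) :=
    funext fun i => by ring
  have h := multipliable_one_sub_mul_pow hq (x * q)
  rw [shift] at h
  simpa only [qPochInf, shift, pow_zero, mul_one] using
    tprod_eq_zero_mul' (f := fun i : ℕ => 1 - x * q ^ i) h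

theorem qPoch_self_succ (q : ℂ) (k : ℕ) : qPoch q q (k + 1) = qPoch q q k * (1 - q ^ (k + 1)) := by
  rw [qPoch, Finset.prod_range_succ, pow_succ', qPoch]

theorem one_sub_pow_succ_ne_zero (hq : ‖q‖ < 1) (k : ℕ) : 1 - q ^ (k + 1) ≠ 0 := fun h => by
  have := pow_lt_one₀ (norm_nonneg q) hq k.succ_ne_zero
  rw [← norm_pow, ← sub_eq_zero.mp h, norm_one] at this
  exact lt_irrefl _ this

theorem qPoch_self_ne_zero (hq : ‖q‖ < 1) (k : ℕ) : qPoch q q k ≠ 0 :=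
  Finset.prod_ne_zero_iff.mpr fun i _ => by
    simpa only [← pow_succ'] using one_sub_pow_succ_ne_zero hq i

theorem qPochInf_self_ne_zero (hq : ‖q‖ < 1) : qPochInf q q ≠ 0 := by
  simpa only [← sub_eq_add_neg, qPochInf] using
    tprod_one_add_ne_zero_of_summable (f := fun i : ℕ => -(q * q ^ i))
      (fun i => by simpa only [← sub_eq_add_neg, ← pow_succ'] using one_sub_pow_succ_ne_zero hq i)
      (summable_norm_neg_mul_pow hq q)

theorem norm_qPochInf_sub_one_le (hq : ‖q‖ < 1) (x : ℂ) :
    ‖qPochInf x q - 1‖ ≤ Real.exp (‖x‖ * (1 - ‖q‖)⁻¹) - 1 := by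
  refine le_of_tendsto ((tendsto_qPoch hq x).sub_const 1).norm (Eventually.of_forall fun k => ?_)
  have h := Finset.norm_prod_one_add_sub_one_le (Finset.range k) fun i => -(x * q ^ i)
  simp only [← sub_eq_add_neg] at h
  refine h.trans (sub_le_sub_right (Real.exp_le_exp.mpr ?_) 1)
  calc ∑ i ∈ Finset.range k, ‖-(x * q ^ i)‖
      ≤ ∑' i : ℕ, ‖-(x * q ^ i)‖ :=
        (summable_norm_neg_mul_pow hq x).sum_le_tsum _ fun _ _ => norm_nonneg _
    _ = ‖x‖ * (1 - ‖q‖)⁻¹ := by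
        simp only [norm_neg, norm_mul, norm_pow, tsum_mul_left,
          tsum_geometric_of_lt_one (norm_nonneg q) hq]

theorem norm_qPochInf_le (hq : ‖q‖ < 1) (x : ℂ) :
    ‖qPochInf x q‖ ≤ Real.exp (‖x‖ * (1 - ‖q‖)⁻¹) := by
  have h := norm_le_norm_sub_add (qPochInf x q) 1
  rw [norm_one] at h
  linarith [norm_qPochInf_sub_one_le hq x]

theorem tendsto_qPochInf_of_tendsto_zero (hq : ‖q‖ < 1) {ι : Type*} {l : Filter ι} {f : ι → ℂ}
    (hf : Tendsto f l (𝓝 0)) : Tendsto (fun i => qPochInf (f i) q) l (𝓝 1) := by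
  refine tendsto_iff_norm_sub_tendsto_zero.mpr <|
    squeeze_zero (fun _ => norm_nonneg _) (fun i => norm_qPochInf_sub_one_le hq (f i)) ?_
  simpa using ((hf.norm.mul_const (1 - ‖q‖)⁻¹).rexp).sub_const 1

theorem norm_qPochInf_le_of_norm_mul_pow_le (hq : ‖q‖ < 1) (hq0 : q ≠ 0) {R : ℝ} (n : ℕ) {x : ℂ}
    (hx : ‖x‖ * ‖q‖ ^ n ≤ R) :
    ‖qPochInf x q‖ ≤ Real.exp (R * ((1 - ‖q‖)⁻¹ + n) - Real.log ‖q‖ * (n * (n + 1) / 2)) := by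
  have hq_pos : 0 < ‖q‖ := norm_pos_iff.mpr hq0
  induction n generalizing x with
  | zero =>
    refine (norm_qPochInf_le hq x).trans (Real.exp_le_exp.mpr ?_)
    have : 0 ≤ (1 - ‖q‖)⁻¹ := inv_nonneg.mpr (sub_nonneg.mpr hq.le)
    simpa using mul_le_mul_of_nonneg_right hx this
  | succ n ih =>
    have factor_le : ‖1 - x‖ ≤ Real.exp (R - Real.log ‖q‖ * (n + 1)) :=
      calc ‖1 - x‖ ≤ 1 + ‖x‖ := by simpa using norm_sub_le 1 x
        _ ≤ (‖q‖ ^ (n + 1))⁻¹ * (1 + R) := by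
            rw [← div_eq_inv_mul, le_div_iff₀ (pow_pos hq_pos _), add_mul, one_mul]
            exact add_le_add (pow_le_one₀ hq_pos.le hq.le) hx
        _ ≤ (‖q‖ ^ (n + 1))⁻¹ * Real.exp R := by
            gcongr
            linarith [Real.add_one_le_exp R]
        _ = _ := by
            rw [sub_eq_neg_add, Real.exp_add, Real.exp_neg, mul_comm (Real.log _), ← Nat.cast_succ,
              Real.exp_nat_mul, Real.exp_log hq_pos]
    have tail_le := ih (x := x * q) (by rwa [norm_mul, mul_assoc, ← pow_succ'])
    calc ‖qPochInf x q‖ = ‖1 - x‖ * ‖qPochInf (x * q) q‖ := by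
          rw [qPochInf_eq_one_sub_mul hq, norm_mul]
      _ ≤ _ := mul_le_mul factor_le tail_le (norm_nonneg _) (Real.exp_nonneg _)
      _ = _ := by
          rw [← Real.exp_add]
          push_cast
          ring_nf

theorem exists_gaussianBounded_norm_qPochInf_le (hq : ‖q‖ < 1) (hq0 : q ≠ 0) (z : ℂ) :
    ∃ g : ℤ → ℝ, GaussianBounded (Real.log ‖q‖ / 2) g ∧
      ∀ (m : ℤ) (x : ℂ), ‖x‖ ≤ ‖z * q ^ m‖ → ‖qPochInf x q‖ ≤ g m := by
  have hq_pos : 0 < ‖q‖ := norm_pos_iff.mpr hq0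
  have hlog : Real.log ‖q‖ ≤ 0 := Real.log_nonpos hq_pos.le hq.le
  have hinv : 0 ≤ (1 - ‖q‖)⁻¹ := inv_nonneg.mpr (sub_nonneg.mpr hq.le)
  set b := ‖z‖ * ((1 - ‖q‖)⁻¹ + 1) - Real.log ‖q‖ / 2
  refine ⟨fun m => Real.exp (b * (1 + |(m : ℝ)|) - Real.log ‖q‖ / 2 * (m : ℝ) ^ 2),
    ⟨b, fun m => (Real.norm_of_nonneg (Real.exp_nonneg _)).le⟩, fun m x hx => ?_⟩
  obtain ⟨n, hnm, hn⟩ : ∃ n : ℕ, 0 ≤ m + n ∧ (n : ℝ) ≤ |(m : ℝ)| := by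
    refine ⟨(-m).toNat, by omega, ?_⟩
    exact_mod_cast (by rw [Int.abs_eq_natAbs]; omega : ((-m).toNat : ℤ) ≤ |m|)
  have hxn : ‖x‖ * ‖q‖ ^ n ≤ ‖z‖ :=
    calc ‖x‖ * ‖q‖ ^ n ≤ ‖z * q ^ m‖ * ‖q‖ ^ n := by gcongr
      _ = ‖z‖ * ‖q‖ ^ (m + n) := by
          rw [norm_mul, norm_zpow, mul_assoc, zpow_add₀ hq_pos.ne', zpow_natCast]
      _ ≤ ‖z‖ := mul_le_of_le_one_right (norm_nonneg z) (zpow_le_one₀ hq_pos hq.le hnm)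
  refine (norm_qPochInf_le_of_norm_mul_pow_le hq hq0 n hxn).trans (Real.exp_le_exp.mpr ?_)
  rw [← sq_abs (m : ℝ)]
  have linear : ‖z‖ * ((1 - ‖q‖)⁻¹ + n) ≤ ‖z‖ * (((1 - ‖q‖)⁻¹ + 1) * (1 + |(m : ℝ)|)) := by
    gcongr
    linarith [mul_nonneg hinv (abs_nonneg (m : ℝ))]
  have quadratic : -Real.log ‖q‖ / 2 * ((n : ℝ) ^ 2 + n) ≤
      -Real.log ‖q‖ / 2 * (|(m : ℝ)| ^ 2 + |(m : ℝ)| + 1) := by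
    refine mul_le_mul_of_nonneg_left ?_ (by linarith)
    exact (add_le_add (pow_le_pow_left₀ n.cast_nonneg hn 2) hn).trans (by linarith)
  linear_combination linear + quadratic

theorem gaussianBounded_qPochInf_mul_zpow (hq : ‖q‖ < 1) (hq0 : q ≠ 0) (z : ℂ) :
    GaussianBounded (Real.log ‖q‖ / 2) fun j : ℤ => qPochInf (z * q ^ j) q :=
  let ⟨_, ⟨b, hb⟩, hg⟩ := exists_gaussianBounded_norm_qPochInf_le hq hq0 z
  ⟨b, fun j => (hg j _ le_rfl).trans ((Real.le_norm_self _).trans (hb j))⟩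

/-- The reciprocal `1 / (q)_n` for an integer `n`, read as `0` when `n` is negative. -/
noncomputable def qPochInv (q : ℂ) (n : ℤ) : ℂ := if n < 0 then 0 else (qPoch q q n.toNat)⁻¹

theorem qPochInv_of_neg (q : ℂ) {n : ℤ} (h : n < 0) : qPochInv q n = 0 := if_pos h

theorem qPochInv_natCast (q : ℂ) (n : ℕ) : qPochInv q n = (qPoch q q n)⁻¹ := by
  simp [qPochInv]

theorem one_sub_zpow_mul_qPochInv (hq : ‖q‖ < 1) (n : ℤ) :
    (1 - q ^ n) * qPochInv q n = qPochInv q (n - 1) := by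
  rcases lt_trichotomy n 0 with h | rfl | h
  · rw [qPochInv_of_neg q h, qPochInv_of_neg q (by omega), mul_zero]
  · rw [zpow_zero, sub_self, zero_mul, qPochInv_of_neg q (by norm_num)]
  · obtain ⟨m, rfl⟩ : ∃ m : ℕ, n = (m + 1 : ℕ) := ⟨(n - 1).toNat, by omega⟩
    rw [Nat.cast_succ, add_sub_cancel_right, ← Nat.cast_succ, zpow_natCast, qPochInv_natCast,
      qPochInv_natCast, qPoch_self_succ, mul_inv_rev,
      mul_inv_cancel_left₀ (one_sub_pow_succ_ne_zero hq m)]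

theorem tendsto_qPochInv (hq : ‖q‖ < 1) : Tendsto (qPochInv q) atTop (𝓝 (qPochInf q q)⁻¹) := by
  have h := ((tendsto_qPoch hq q).inv₀ (qPochInf_self_ne_zero hq)).comp
    (tendsto_atTop_atTop.mpr fun b => ⟨b, fun n hn => by omega⟩ : Tendsto Int.toNat atTop atTop)
  refine h.congr' ?_
  filter_upwards [eventually_ge_atTop 0] with n hn
  rw [qPochInv, if_neg hn.not_gt, Function.comp]

theorem exists_norm_qPochInv_le (hq : ‖q‖ < 1) : ∃ C, ∀ n, ‖qPochInv q n‖ ≤ C := by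
  obtain ⟨C, hC⟩ := ((tendsto_qPochInv hq).comp tendsto_natCast_atTop_atTop).norm.bddAbove_range
  refine ⟨C, fun n => ?_⟩
  rcases lt_or_ge n 0 with h | h
  · rw [qPochInv_of_neg q h, norm_zero]
    exact (norm_nonneg _).trans (hC ⟨0, rfl⟩)
  · lift n to ℕ using h
    exact hC ⟨n, rfl⟩

end QPochhammer

section Bailey

variable {q z : ℂ}

/-- A limiting case of the `q`-Chu–Vandermonde summation. -/
theorem sum_antidiagonal_mul_qPochInf (hq : ‖q‖ < 1) (n : ℕ) (y : ℂ) :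
    ∑ p ∈ antidiagonal n, y ^ p.1 * q ^ (p.1 ^ 2) * qPochInf (y * q ^ (1 + p.1)) q /
      (qPoch q q p.1 * qPoch q q p.2) = qPochInf (y * q ^ (1 + n)) q / qPoch q q n := by
  induction n generalizing y with
  | zero => simp [qPoch]
  | succ n ih =>
    have hne := one_sub_pow_succ_ne_zero hq
    have := qPoch_self_ne_zero hq
    set c : ℕ × ℕ → ℂ := fun p => y ^ p.1 * q ^ (p.1 ^ 2) * qPochInf (y * q ^ (1 + p.1)) q /
      (qPoch q q p.1 * qPoch q q p.2)
    have split : ∀ p ∈ antidiagonal (n + 1),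
        (1 - q ^ (n + 1)) * c p = (1 - q ^ p.2) * c p + q ^ p.2 * (1 - q ^ p.1) * c p := by
      intro p hp
      rw [← mem_antidiagonal.mp hp, pow_add]
      ring
    have first : ∑ p ∈ antidiagonal (n + 1), (1 - q ^ p.2) * c p =
        qPochInf (y * q ^ (1 + n)) q / qPoch q q n := by
      rw [Finset.Nat.sum_antidiagonal_succ', pow_zero, sub_self, zero_mul, zero_add, ← ih y]
      refine Finset.sum_congr rfl fun p _ => ?_
      simp only [c, qPoch_self_succ]
      have := hne p.2
      field_simp
    have second : ∑ p ∈ antidiagonal (n + 1), q ^ p.2 * (1 - q ^ p.1) * c p =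
        y * q ^ (n + 1) * (qPochInf (y * q * q ^ (1 + n)) q / qPoch q q n) := by
      rw [Finset.Nat.sum_antidiagonal_succ, pow_zero, sub_self, mul_zero, zero_mul, zero_add,
        ← ih (y * q), Finset.mul_sum]
      refine Finset.sum_congr rfl fun p hp => ?_
      rw [← mem_antidiagonal.mp hp]
      simp only [c, qPoch_self_succ, show y * q ^ (1 + (p.1 + 1)) = y * q * q ^ (1 + p.1) by ring]
      have := hne p.1
      field_simp
      ring
    apply mul_left_cancel₀ (hne n)
    rw [Finset.mul_sum, Finset.sum_congr rfl split, Finset.sum_add_distrib, first, second,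
      qPochInf_eq_one_sub_mul hq (y * q ^ (1 + n)), qPoch_self_succ,
      show y * q ^ (1 + n) * q = y * q ^ (1 + (n + 1)) by ring,
      show y * q * q ^ (1 + n) = y * q ^ (1 + (n + 1)) by ring]
    have := hne n
    field_simp
    ring

theorem hasSum_qPochInv_mul_qPochInv (q : ℂ) (f : ℤ → ℂ) (j : ℤ) (n : ℕ) :
    HasSum (fun r : ℤ => f r * (qPochInv q (j + n - r) * qPochInv q (r - j)))
      (∑ p ∈ antidiagonal n, f (j + p.1) / (qPoch q q p.1 * qPoch q q p.2)) := by
  have support : ∀ r ∉ Finset.Icc j (j + n),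
      f r * (qPochInv q (j + n - r) * qPochInv q (r - j)) = 0 := fun r hr => by
    rcases lt_or_ge r j with h | h
    · rw [qPochInv_of_neg q (sub_neg.mpr h), mul_zero, mul_zero]
    · rw [qPochInv_of_neg q (sub_neg.mpr (by rw [Finset.mem_Icc] at hr; omega)), zero_mul, mul_zero]
  convert hasSum_sum_of_ne_finset_zero support (L := .unconditional ℤ) using 1
  refine Finset.sum_nbij' (fun p => j + p.1) (fun r => ((r - j).toNat, (j + n - r).toNat))
    ?_ ?_ ?_ ?_ ?_
  · simp only [Finset.mem_Icc, mem_antidiagonal]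
    omega
  · simp only [Finset.mem_Icc, mem_antidiagonal]
    omega
  · simp only [mem_antidiagonal, Prod.ext_iff]
    omega
  · simp only [Finset.mem_Icc]
    omega
  · simp only [mem_antidiagonal]
    rintro p rfl
    rw [show j + ((p.1 + p.2 : ℕ) : ℤ) - (j + p.1) = p.2 by push_cast; ring, add_sub_cancel_left,
      qPochInv_natCast, qPochInv_natCast, div_eq_mul_inv, mul_inv_rev]

/-- The kernel `1 / ((q)_{L - j} (zq)_{L + j})` of Bailey's transform, normalised by the factor
`(zq)_∞` so that it is entire in `z`. -/
noncomputable def baileyKernel (q z : ℂ) (L j : ℤ) : ℂ :=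
  qPochInf (z * q ^ (1 + L + j)) q * qPochInv q (L - j)

theorem hasSum_baileyKernel (hq : ‖q‖ < 1) (hq0 : q ≠ 0) (hz : z ≠ 0) (L j : ℤ) :
    HasSum (fun r : ℤ => z ^ r * q ^ (r ^ 2) * qPochInv q (L - r) * baileyKernel q z r j)
      (z ^ j * q ^ (j ^ 2) * baileyKernel q z L j) := by
  rcases lt_or_ge L j with h | h
  · rw [baileyKernel, qPochInv_of_neg q (sub_neg.mpr h), mul_zero, mul_zero]
    convert hasSum_zero using 2 with r
    rcases lt_or_ge r j with hr | hr
    · rw [baileyKernel, qPochInv_of_neg q (sub_neg.mpr hr), mul_zero, mul_zero]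
    · rw [qPochInv_of_neg q (sub_neg.mpr (h.trans_le hr)), mul_zero, zero_mul]
  · obtain ⟨n, rfl⟩ := Int.le.dest h
    have shift : ∀ k : ℕ, z * q ^ (1 + (j + k) + j) = z * q ^ (2 * j) * q ^ (1 + k) := fun k => by
      rw [mul_assoc, ← zpow_natCast q (1 + k), ← zpow_add₀ hq0]
      congr 2
      push_cast
      ring
    have power : ∀ k : ℕ, z ^ (j + k) * q ^ ((j + k) ^ 2) =
        z ^ j * q ^ (j ^ 2) * ((z * q ^ (2 * j)) ^ k * q ^ (k ^ 2)) := fun k => by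
      rw [mul_pow, ← zpow_natCast (q ^ (2 * j)), ← zpow_mul, zpow_add₀ hz, zpow_natCast,
        show (j + k : ℤ) ^ 2 = j ^ 2 + 2 * j * k + (k ^ 2 : ℕ) by push_cast; ring,
        zpow_add₀ hq0, zpow_add₀ hq0, zpow_natCast]
      ring
    convert hasSum_qPochInv_mul_qPochInv q
      (fun r => z ^ r * q ^ (r ^ 2) * qPochInf (z * q ^ (1 + r + j)) q) j n using 1
    · funext r
      rw [baileyKernel]
      ring
    · rw [baileyKernel, shift, add_sub_cancel_left, qPochInv_natCast, ← div_eq_mul_inv,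
        ← sum_antidiagonal_mul_qPochInf hq, Finset.mul_sum]
      refine Finset.sum_congr rfl fun p _ => ?_
      rw [power, shift]
      ring

theorem gaussianBounded_baileyKernel (hq : ‖q‖ < 1) (hq0 : q ≠ 0) (z : ℂ) (L : ℤ) :
    GaussianBounded (Real.log ‖q‖ / 2) (baileyKernel q z L) := by
  obtain ⟨C, hC⟩ := exists_norm_qPochInv_le hq
  have h := (gaussianBounded_qPochInf_mul_zpow hq hq0 (z * q ^ (1 + L))).mul
    (.of_norm_le fun j => hC (L - j))
  simp only [add_zero, mul_assoc, ← zpow_add₀ hq0] at h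
  exact h

theorem tendsto_baileyKernel (hq : ‖q‖ < 1) (hq0 : q ≠ 0) (z : ℂ) (j : ℤ) :
    Tendsto (fun L : ℕ => baileyKernel q z L j) atTop (𝓝 (qPochInf q q)⁻¹) := by
  have argument : Tendsto (fun L : ℕ => z * q ^ (1 + (L : ℤ) + j)) atTop (𝓝 0) := by
    have h := (tendsto_pow_atTop_nhds_zero_of_norm_lt_one hq).const_mul (z * q ^ (1 + j))
    simpa only [mul_zero, mul_assoc, ← zpow_natCast q, ← zpow_add₀ hq0, add_right_comm] using h
  have h := (tendsto_qPochInf_of_tendsto_zero hq argument).mul ((tendsto_qPochInv hq).comp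
    (tendsto_atTop_add_const_right atTop (-j) tendsto_natCast_atTop_atTop))
  rwa [one_mul] at h

/-- The summand of the numerator of the Weyl–Kac formula for affine `sl₂` at level `N`. -/
noncomputable def weylTerm (N : ℕ) (q z : ℂ) (j : ℤ) : ℂ :=
  z ^ ((N + 2) * j) * q ^ ((N + 2) * j ^ 2 - j) * (1 - z * q ^ (2 * j))

/-- Bailey's transform `β_L = ∑_j α_j / ((q)_{L - j} (zq)_{L + j})` of the bilateral sequence
`weylTerm N q z`, with the normalisation of `baileyKernel`. -/
noncomputable def baileySum (N : ℕ) (q z : ℂ) (L : ℤ) : ℂ :=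
  ∑' j, weylTerm N q z j * baileyKernel q z L j

theorem weylTerm_succ (hq0 : q ≠ 0) (hz : z ≠ 0) (N : ℕ) (j : ℤ) :
    weylTerm (N + 1) q z j = weylTerm N q z j * (z ^ j * q ^ (j ^ 2)) := by
  rw [weylTerm, weylTerm, show ((N + 1 : ℕ) + 2 : ℤ) * j = (N + 2) * j + j by push_cast; ring,
    show ((N + 1 : ℕ) + 2 : ℤ) * j ^ 2 - j = ((N + 2) * j ^ 2 - j) + j ^ 2 by push_cast; ring,
    zpow_add₀ hz, zpow_add₀ hq0]
  ring

theorem gaussianBounded_weylTerm (hq0 : q ≠ 0) (hz : z ≠ 0) (N : ℕ) :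
    GaussianBounded (-((N + 2) * Real.log ‖q‖)) (weylTerm N q z) := by
  have monomial := GaussianBounded.zpow_mul_zpow_quadratic hz hq0 (N + 2) (N + 2) (-1)
  have one : GaussianBounded 0 fun _ => (1 : ℂ) := .of_norm_le fun _ => le_rfl
  have factor := one.sub ((GaussianBounded.zpow (zpow_ne_zero 2 hq0)).const_mul z)
  have h := monomial.mul factor
  simp only [neg_one_mul, ← sub_eq_add_neg, ← zpow_mul, add_zero, Int.cast_add, Int.cast_natCast,
    Int.cast_ofNat] at h
  exact h

theorem log_norm_neg (hq : ‖q‖ < 1) (hq0 : q ≠ 0) : Real.log ‖q‖ < 0 :=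
  Real.log_neg (norm_pos_iff.mpr hq0) hq

theorem summable_weylTerm (hq : ‖q‖ < 1) (hq0 : q ≠ 0) (hz : z ≠ 0) (N : ℕ) :
    Summable (weylTerm N q z) :=
  (gaussianBounded_weylTerm hq0 hz N).summable
    (neg_pos.mpr (mul_neg_of_pos_of_neg (by positivity) (log_norm_neg hq hq0)))

theorem summable_weylTerm_mul_baileyKernel (hq : ‖q‖ < 1) (hq0 : q ≠ 0) (hz : z ≠ 0) (N : ℕ)
    (L : ℤ) : Summable fun j => weylTerm N q z j * baileyKernel q z L j := by
  refine ((gaussianBounded_weylTerm hq0 hz N).mul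
    (gaussianBounded_baileyKernel hq hq0 z L)).summable ?_
  have : 0 ≤ (N : ℝ) := N.cast_nonneg
  nlinarith [log_norm_neg hq hq0]

/-- A sequence whose differences telescope the increments of `baileySum 0`. -/
noncomputable def levelZeroTelescope (q z : ℂ) (L j : ℤ) : ℂ :=
  q ^ L * (z ^ (2 * j) * q ^ (2 * j ^ 2 + -2 * j)) * baileyKernel q (z * q⁻¹) L j

theorem summable_levelZeroTelescope (hq : ‖q‖ < 1) (hq0 : q ≠ 0) (hz : z ≠ 0) (L : ℤ) :
    Summable (levelZeroTelescope q z L) := by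
  have h := ((GaussianBounded.zpow_mul_zpow_quadratic hz hq0 2 2 (-2)).const_mul (q ^ L)).mul
    (gaussianBounded_baileyKernel hq hq0 (z * q⁻¹) L)
  refine h.summable ?_
  push_cast
  linarith [log_norm_neg hq hq0]

theorem weylTerm_zero_mul_baileyKernel_sub (hq : ‖q‖ < 1) (hq0 : q ≠ 0) (hz : z ≠ 0) (L j : ℤ) :
    weylTerm 0 q z j * baileyKernel q z L j - weylTerm 0 q z j * baileyKernel q z (L - 1) j =
      levelZeroTelescope q z L j - levelZeroTelescope q z L (j + 1) := by
  have shift : ∀ m : ℤ, z * q⁻¹ * q ^ (1 + m) = z * q ^ m := fun m => by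
    rw [zpow_add₀ hq0, zpow_one, mul_assoc, inv_mul_cancel_left₀ hq0]
  have monomial : z ^ (2 * (j + 1)) * q ^ (2 * (j + 1) ^ 2 + -2 * (j + 1)) =
      z ^ (2 * j) * q ^ (2 * j ^ 2 + -2 * j) * (z ^ 2 * (q ^ j) ^ 4) := by
    rw [mul_add, zpow_add₀ hz,
      show 2 * (j + 1) ^ 2 + -2 * (j + 1) = 2 * j ^ 2 + -2 * j + j * 4 by ring, zpow_add₀ hq0,
      zpow_mul q j 4]
    norm_cast
    ring
  have weyl : weylTerm 0 q z j =
      z ^ (2 * j) * q ^ (2 * j ^ 2 + -2 * j) * (q ^ j * (1 - z * (q ^ j) ^ 2)) := by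
    rw [weylTerm, show ((0 : ℕ) + 2 : ℤ) * j ^ 2 - j = 2 * j ^ 2 + -2 * j + j by push_cast; ring,
      zpow_add₀ hq0 _ j, mul_comm 2 j, zpow_mul q j 2]
    norm_cast
    ring_nf
  rw [levelZeroTelescope, levelZeroTelescope, monomial, weyl, baileyKernel, baileyKernel,
    baileyKernel, baileyKernel, add_assoc 1 L j, add_assoc 1 L (j + 1), shift, shift,
    show 1 + (L - 1) + j = L + j by ring, show L - 1 - j = L - j - 1 by ring,
    show L - (j + 1) = L - j - 1 by ring, ← one_sub_zpow_mul_qPochInv hq (L - j),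
    qPochInf_eq_one_sub_mul hq (z * q ^ (L + j)), mul_assoc z, ← zpow_add_one₀ hq0,
    show 1 + (L + j) = L + (j + 1) by ring, add_assoc L j 1, zpow_sub₀ hq0, zpow_add₀ hq0 L j]
  have := zpow_ne_zero j hq0
  field_simp
  ring

theorem baileySum_zero_sub_one (hq : ‖q‖ < 1) (hq0 : q ≠ 0) (hz : z ≠ 0) (L : ℤ) :
    baileySum 0 q z (L - 1) = baileySum 0 q z L := by
  have hT := summable_levelZeroTelescope hq hq0 hz L
  have shift : HasSum (fun j => levelZeroTelescope q z L (j + 1))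
      (∑' j, levelZeroTelescope q z L j) :=
    (Equiv.addRight (1 : ℤ)).hasSum_iff (f := levelZeroTelescope q z L) |>.mpr hT.hasSum
  symm
  rw [← sub_eq_zero, baileySum, baileySum,
    ← (summable_weylTerm_mul_baileyKernel hq hq0 hz 0 L).tsum_sub
      (summable_weylTerm_mul_baileyKernel hq hq0 hz 0 (L - 1)),
    tsum_congr (weylTerm_zero_mul_baileyKernel_sub hq hq0 hz L), hT.tsum_sub shift.summable,
    shift.tsum_eq, sub_self]

theorem baileySum_zero_eq (hq : ‖q‖ < 1) (hq0 : q ≠ 0) (hz : z ≠ 0) (L : ℤ) :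
    baileySum 0 q z L = baileySum 0 q z 0 := by
  induction L using Int.induction_on with
  | zero => rfl
  | succ n ih => rw [← baileySum_zero_sub_one hq hq0 hz, add_sub_cancel_right, ih]
  | pred n ih => rw [baileySum_zero_sub_one hq hq0 hz, ih]

theorem summable_weylTerm_mul_baileyKernel_prod (hq : ‖q‖ < 1) (hq0 : q ≠ 0) (hz : z ≠ 0) (N : ℕ)
    (L : ℤ) : Summable fun p : ℤ × ℤ => weylTerm N q z p.1 *
      (z ^ p.2 * q ^ (p.2 ^ 2) * qPochInv q (L - p.2) * baileyKernel q z p.2 p.1) := by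
  have hlog := log_norm_neg hq hq0
  obtain ⟨C, hC⟩ := exists_norm_qPochInv_le hq
  have outer := ((GaussianBounded.zpow hz).mul (.zpow_sq hq0)).mul
    (.of_norm_le fun r => hC (L - r))
  have poch := gaussianBounded_qPochInf_mul_zpow hq hq0 (z * q)
  rw [← neg_neg (Real.log ‖q‖ / 2)] at poch
  have hN : 0 ≤ (N : ℝ) := N.cast_nonneg
  have dominating := (gaussianBounded_weylTerm hq0 hz N).summable_mul_mul_add outer poch
    (by nlinarith) (by linarith) (by linarith)
    (by nlinarith [mul_nonneg hN (sq_nonneg (Real.log ‖q‖)), sq_pos_of_neg hlog])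
  refine .of_norm_bounded (dominating.mul_right C) fun ⟨j, r⟩ => ?_
  rw [baileyKernel, show z * q ^ (1 + r + j) = z * q * q ^ (j + r) by
      rw [mul_assoc, ← zpow_one_add₀ hq0]; ring_nf]
  simp only [norm_mul]
  rw [mul_assoc (‖weylTerm _ _ _ _‖ * _), mul_assoc ‖weylTerm _ _ _ _‖]
  gcongr
  exact hC _

/-- Bailey's lemma in bilateral form. -/
theorem hasSum_baileySum (hq : ‖q‖ < 1) (hq0 : q ≠ 0) (hz : z ≠ 0) (N : ℕ) (L : ℤ) :
    HasSum (fun r : ℤ => z ^ r * q ^ (r ^ 2) * qPochInv q (L - r) * baileySum N q z r)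
      (baileySum (N + 1) q z L) := by
  have hs := summable_weylTerm_mul_baileyKernel_prod hq hq0 hz N L
  have inner : ∀ j, ∑' r : ℤ, weylTerm N q z j * (z ^ r * q ^ (r ^ 2) * qPochInv q (L - r) *
      baileyKernel q z r j) = weylTerm (N + 1) q z j * baileyKernel q z L j := fun j => by
    rw [tsum_mul_left, (hasSum_baileyKernel hq hq0 hz L j).tsum_eq, ← mul_assoc,
      weylTerm_succ hq0 hz]
  have total := hs.hasSum
  rw [hs.tsum_prod, tsum_congr inner, ← baileySum] at total
  have swapped := (Equiv.prodComm ℤ ℤ).hasSum_iff.mpr total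
  refine swapped.prod_fiberwise fun r => ?_
  simpa only [baileySum, Function.comp_apply, Equiv.prodComm_apply, Prod.swap_prod_mk,
    mul_left_comm (weylTerm _ _ _ _)] using
    (summable_weylTerm_mul_baileyKernel hq hq0 hz N r).hasSum.mul_left
      (z ^ r * q ^ (r ^ 2) * qPochInv q (L - r))

theorem tendsto_baileySum (hq : ‖q‖ < 1) (hq0 : q ≠ 0) (hz : z ≠ 0) (N : ℕ) :
    Tendsto (fun L : ℕ => baileySum N q z L) atTop
      (𝓝 ((∑' j, weylTerm N q z j) * (qPochInf q q)⁻¹)) := by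
  obtain ⟨g, hg, hbound⟩ := exists_gaussianBounded_norm_qPochInf_le hq hq0 (z * q)
  obtain ⟨C, hC⟩ := exists_norm_qPochInv_le hq
  have kernel_le : ∀ (L : ℕ) (j : ℤ), ‖baileyKernel q z L j‖ ≤ g j * C := fun L j => by
    have argument_le : ‖z * q ^ (1 + (L : ℤ) + j)‖ ≤ ‖z * q * q ^ j‖ := by
      rw [show 1 + (L : ℤ) + j = L + (1 + j) by ring, zpow_add₀ hq0, zpow_one_add₀ hq0,
        zpow_natCast, mul_left_comm, mul_assoc z, norm_mul, norm_pow]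
      exact mul_le_of_le_one_left (norm_nonneg _) (pow_le_one₀ (norm_nonneg q) hq.le)
    rw [baileyKernel, norm_mul]
    exact mul_le_mul (hbound j _ argument_le) (hC _) (norm_nonneg _)
      ((norm_nonneg _).trans (hbound j _ argument_le))
  have dominating : Summable fun j => ‖weylTerm N q z j‖ * (g j * C) := by
    refine ((gaussianBounded_weylTerm hq0 hz N).norm.mul
      (hg.mul (.of_norm_le fun _ => le_rfl))).summable ?_
    have : 0 ≤ (N : ℝ) := N.cast_nonneg
    nlinarith [log_norm_neg hq hq0]
  rw [← tsum_mul_right]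
  refine tendsto_tsum_of_dominated_convergence dominating
    (fun j => (tendsto_baileyKernel hq hq0 z j).const_mul _) (.of_forall fun L j => ?_)
  rw [norm_mul]
  exact mul_le_mul_of_nonneg_left (kernel_le L j) (norm_nonneg _)

end Bailey

section Chain

theorem zpow_sum₀ {G ι : Type*} [CommGroupWithZero G] {x : G} (hx : x ≠ 0) (s : Finset ι)
    (f : ι → ℤ) : x ^ ∑ i ∈ s, f i = ∏ i ∈ s, x ^ f i := by
  induction s using Finset.cons_induction with
  | empty => simp
  | cons i s hi ih => rw [Finset.sum_cons, Finset.prod_cons, zpow_add₀ hx, ih]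

theorem summable_fin_prod {ι : Type*} {f : ι → ℝ} (hf : Summable f) (hf0 : ∀ i, 0 ≤ f i) (n : ℕ) :
    Summable fun v : Fin n → ι => ∏ i, f (v i) := by
  induction n with
  | zero => exact .of_finite
  | succ n ih =>
    refine (Fin.consEquiv fun _ => ι).summable_iff.mp ?_
    simpa only [Function.comp_def, Fin.consEquiv_apply, Fin.prod_univ_succ, Fin.cons_zero,
      Fin.cons_succ] using
      hf.mul_of_nonneg ih hf0 fun v => Finset.prod_nonneg fun i _ => hf0 (v i)

variable {q z : ℂ} {n : ℕ}

/-- The decreasing chain of integers that starts with `r` and has successive differences `η`. -/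
def chain (r : ℤ) (η : Fin n → ℕ) (i : Fin (n + 1)) : ℤ := r - Fin.partialSum (fun l => (η l : ℤ)) i

/-- The weight `q ^ (∑ v_i²) / ∏ (q)_{v_i - v_{i+1}}` of the chain `v` with first entry `r` and
successive differences `η`. -/
noncomputable def chainTerm (q : ℂ) (r : ℤ) (η : Fin n → ℕ) : ℂ :=
  q ^ (∑ i, chain r η i ^ 2) / ∏ i, qPoch q q (η i)

/-- The generating function of the chains of `n + 1` integers with first entry `r`. -/
noncomputable def chainSum (n : ℕ) (q z : ℂ) (r : ℤ) : ℂ :=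
  ∑' η : Fin n → ℕ, z ^ (∑ i, chain r η i) * chainTerm q r η

theorem chain_zero (r : ℤ) (η : Fin n → ℕ) : chain r η 0 = r := by
  rw [chain, Fin.partialSum_zero, sub_zero]

theorem chain_castSucc_sub_succ (r : ℤ) (η : Fin n → ℕ) (l : Fin n) :
    chain r η l.castSucc - chain r η l.succ = η l := by
  rw [chain, chain, Fin.partialSum_succ, sub_sub_sub_cancel_left, add_sub_cancel_left]

theorem chain_cons_succ (r : ℤ) (k : ℕ) (η : Fin n → ℕ) (i : Fin (n + 1)) :
    chain r (Fin.cons k η) i.succ = chain (r - k) η i := by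
  rw [chain, chain, Fin.partialSum_succ', ← sub_sub]
  rfl

theorem chain_injective : Function.Injective fun p : ℤ × (Fin n → ℕ) => chain p.1 p.2 := by
  rintro ⟨r, η⟩ ⟨r', η'⟩ h
  have entry (i : Fin (n + 1)) : chain r η i = chain r' η' i := congrFun h i
  refine Prod.ext ?_ (funext fun l => ?_)
  · simpa only [chain_zero] using entry 0
  · have := chain_castSucc_sub_succ r η l
    rw [entry, entry, chain_castSucc_sub_succ] at this
    exact_mod_cast this.symm

theorem chainTerm_cons (hq0 : q ≠ 0) (r : ℤ) (k : ℕ) (η : Fin n → ℕ) :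
    chainTerm q r (Fin.cons k η : Fin (n + 1) → ℕ) =
      q ^ (r ^ 2) * (qPoch q q k)⁻¹ * chainTerm q (r - k) η := by
  rw [chainTerm, chainTerm, Fin.sum_univ_succ, Fin.prod_univ_succ, zpow_add₀ hq0, chain_zero]
  simp only [chain_cons_succ, Fin.cons_zero, Fin.cons_succ]
  ring

theorem chainSum_zero (q z : ℂ) (r : ℤ) : chainSum 0 q z r = z ^ r * q ^ (r ^ 2) := by
  rw [chainSum, tsum_fintype, Fintype.sum_unique, chainTerm, Fin.sum_univ_one, Fin.sum_univ_one,
    chain_zero, Fin.prod_univ_zero, div_one]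

theorem summable_norm_chainTerm (hq : ‖q‖ < 1) (hq0 : q ≠ 0) (hz : z ≠ 0) (n : ℕ) :
    Summable fun p : ℤ × (Fin n → ℕ) => ‖z ^ (∑ i, chain p.1 p.2 i) * chainTerm q p.1 p.2‖ := by
  obtain ⟨C, hC⟩ := exists_norm_qPochInv_le hq
  have gaussian : Summable fun v : ℤ => ‖z ^ v * q ^ (v ^ 2)‖ :=
    (((GaussianBounded.zpow hz).mul (.zpow_sq hq0)).norm).summable
      (by linarith [log_norm_neg hq hq0])
  have dominating := ((summable_fin_prod gaussian (fun _ => norm_nonneg _) (n + 1)).comp_injective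
    chain_injective).mul_right (C ^ n)
  refine dominating.of_nonneg_of_le (fun _ => norm_nonneg _) fun ⟨r, η⟩ => ?_
  rw [chainTerm, zpow_sum₀ hz, zpow_sum₀ hq0, ← mul_div_assoc, ← Finset.prod_mul_distrib,
    div_eq_mul_inv, ← Finset.prod_inv_distrib, norm_mul, norm_prod, norm_prod]
  refine mul_le_mul_of_nonneg_left ?_ (Finset.prod_nonneg fun _ _ => norm_nonneg _)
  refine (Finset.prod_le_prod (fun _ _ => norm_nonneg _) fun i _ => ?_).trans_eq
    (Fin.prod_const n C)
  rw [← qPochInv_natCast]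
  exact hC _

theorem summable_chainTerm (hq : ‖q‖ < 1) (hq0 : q ≠ 0) (hz : z ≠ 0) (n : ℕ) :
    Summable fun p : ℤ × (Fin n → ℕ) => z ^ (∑ i, chain p.1 p.2 i) * chainTerm q p.1 p.2 :=
  (summable_norm_chainTerm hq hq0 hz n).of_norm

theorem hasSum_chainSum_succ (hq : ‖q‖ < 1) (hq0 : q ≠ 0) (hz : z ≠ 0) (n : ℕ) (r : ℤ) :
    HasSum (fun s : ℤ => z ^ r * q ^ (r ^ 2) * qPochInv q (r - s) * chainSum n q z s)
      (chainSum (n + 1) q z r) := by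
  have cons_term (k : ℕ) (η : Fin n → ℕ) :
      z ^ (∑ i, chain r (Fin.cons k η : Fin (n + 1) → ℕ) i) *
          chainTerm q r (Fin.cons k η : Fin (n + 1) → ℕ) =
        z ^ r * q ^ (r ^ 2) * qPochInv q (r - (r - k)) *
          (z ^ (∑ i, chain (r - k) η i) * chainTerm q (r - k) η) := by
    rw [Fin.sum_univ_succ, zpow_add₀ hz, chain_zero, chainTerm_cons hq0, sub_sub_cancel,
      qPochInv_natCast]
    simp only [chain_cons_succ]
    ring
  have total := (Fin.consEquiv fun _ : Fin (n + 1) => ℕ).hasSum_iff.mpr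
    ((summable_chainTerm hq hq0 hz (n + 1)).prod_factor r).hasSum
  have fibre (k : ℕ) := ((summable_chainTerm hq hq0 hz n).prod_factor (r - k)).hasSum.mul_left
    (z ^ r * q ^ (r ^ 2) * qPochInv q (r - (r - k)))
  simp only [← cons_term] at fibre
  have reflected : Function.Injective fun k : ℕ => r - k := fun k k' h => by simpa using h
  refine (reflected.hasSum_iff fun s hs => ?_).mp (total.prod_fiberwise fibre)
  rw [qPochInv_of_neg q, mul_zero, zero_mul]
  by_contra! hrs
  exact hs ⟨(r - s).toNat, by simp only; omega⟩

theorem mul_baileySum_eq (hq : ‖q‖ < 1) (hq0 : q ≠ 0) (hz : z ≠ 0) (n : ℕ) (r : ℤ) :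
    z ^ r * q ^ (r ^ 2) * baileySum n q z r = baileySum 0 q z 0 * chainSum n q z r := by
  induction n generalizing r with
  | zero => rw [chainSum_zero, baileySum_zero_eq hq hq0 hz, mul_comm]
  | succ n ih =>
    refine ((hasSum_baileySum hq hq0 hz n r).mul_left _).unique ?_
    convert (hasSum_chainSum_succ hq hq0 hz n r).mul_left (baileySum 0 q z 0) using 2 with s
    linear_combination z ^ r * q ^ (r ^ 2) * qPochInv q (r - s) * ih s

theorem tendsto_tsum_qPochInv_mul_chainSum (hq : ‖q‖ < 1) (hq0 : q ≠ 0) (hz : z ≠ 0) (n : ℕ) :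
    Tendsto (fun L : ℕ => ∑' r, qPochInv q (L - r) * chainSum n q z r) atTop
      (𝓝 ((qPochInf q q)⁻¹ * ∑' r, chainSum n q z r)) := by
  have hchain := summable_norm_chainTerm hq hq0 hz n
  obtain ⟨C, hC⟩ := exists_norm_qPochInv_le hq
  rw [← tsum_mul_left]
  refine tendsto_tsum_of_dominated_convergence (hchain.prod.mul_left C) (fun r => ?_)
    (.of_forall fun L r => ?_)
  · exact ((tendsto_qPochInv hq).comp (tendsto_atTop_add_const_right atTop (-r)
      tendsto_natCast_atTop_atTop)).mul_const _
  · rw [norm_mul]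
    exact mul_le_mul (hC _) (norm_tsum_le_tsum_norm (hchain.prod_factor r)) (norm_nonneg _)
      ((norm_nonneg _).trans (hC 0))

theorem tsum_weylTerm_zero_mul_tsum_chainTerm (hq : ‖q‖ < 1) (hq0 : q ≠ 0) (hz : z ≠ 0) (n : ℕ) :
    (∑' j, weylTerm 0 q z j) *
        ∑' p : ℤ × (Fin n → ℕ), z ^ (∑ i, chain p.1 p.2 i) * chainTerm q p.1 p.2 =
      qPochInf q q * ∑' j, weylTerm (n + 1) q z j := by
  have level_zero : baileySum 0 q z 0 = (∑' j, weylTerm 0 q z j) * (qPochInf q q)⁻¹ := by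
    refine tendsto_nhds_unique ?_ (tendsto_baileySum hq hq0 hz 0)
    simp only [baileySum_zero_eq hq hq0 hz, tendsto_const_nhds]
  have expansion (L : ℕ) : baileySum 0 q z 0 * ∑' r, qPochInv q (L - r) * chainSum n q z r =
      baileySum (n + 1) q z L := by
    rw [← (hasSum_baileySum hq hq0 hz n L).tsum_eq, ← tsum_mul_left]
    exact tsum_congr fun r => by
      linear_combination -qPochInv q (L - r) * mul_baileySum_eq hq hq0 hz n r
  have limits_eq := tendsto_nhds_unique
    (((tendsto_tsum_qPochInv_mul_chainSum hq hq0 hz n).const_mul _).congr expansion)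
    (tendsto_baileySum hq hq0 hz (n + 1))
  have := qPochInf_self_ne_zero hq
  rw [level_zero] at limits_eq
  field_simp at limits_eq
  rwa [(summable_chainTerm hq hq0 hz n).tsum_prod]

end Chain

section Laurent

/-- The coefficient of `z ^ m` in the Laurent expansion of `f` on the unit circle. -/
noncomputable def laurentCoeff (f : ℂ → ℂ) (m : ℤ) : ℂ :=
  (2 * Real.pi * Complex.I)⁻¹ * ∮ z in C(0, 1), z ^ (-m - 1) * f z

theorem laurentCoeff_congr {f g : ℂ → ℂ} (h : ∀ z, ‖z‖ = 1 → f z = g z) (m : ℤ) :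
    laurentCoeff f m = laurentCoeff g m := by
  rw [laurentCoeff, laurentCoeff]
  congr 1
  refine circleIntegral.integral_congr zero_le_one fun z hz => ?_
  simp only [h z (mem_sphere_zero_iff_norm.mp hz)]

theorem continuousOn_zpow_unit_sphere (m : ℤ) :
    ContinuousOn (fun z : ℂ => z ^ m) (Metric.sphere 0 1) :=
  continuousOn_id.zpow₀ m fun _ hz => Or.inl (Metric.ne_of_mem_sphere hz one_ne_zero)

theorem circleIntegrable_zpow_mul {f : ℂ → ℂ} (hf : ContinuousOn f (Metric.sphere 0 1)) (m : ℤ) :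
    CircleIntegrable (fun z => z ^ m * f z) 0 1 :=
  ((continuousOn_zpow_unit_sphere m).fun_mul hf).circleIntegrable zero_le_one

theorem laurentCoeff_sub {f g : ℂ → ℂ} (hf : ContinuousOn f (Metric.sphere 0 1))
    (hg : ContinuousOn g (Metric.sphere 0 1)) (m : ℤ) :
    laurentCoeff (fun z => f z - g z) m = laurentCoeff f m - laurentCoeff g m := by
  simp only [laurentCoeff, mul_sub]
  rw [circleIntegral.integral_sub (circleIntegrable_zpow_mul hf _) (circleIntegrable_zpow_mul hg _),
    mul_sub]

theorem laurentCoeff_const_mul_zpow_mul (c : ℂ) (e : ℤ) (f : ℂ → ℂ) (m : ℤ) :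
    laurentCoeff (fun z => c * z ^ e * f z) m = c * laurentCoeff f (m - e) := by
  rw [laurentCoeff, laurentCoeff, mul_left_comm c, ← circleIntegral.integral_const_mul c]
  congr 1
  refine circleIntegral.integral_congr zero_le_one fun z hz => ?_
  rw [show -(m - e) - 1 = -m - 1 + e by ring,
    zpow_add₀ (Metric.ne_of_mem_sphere hz one_ne_zero)]
  ring

theorem laurentCoeff_one (m : ℤ) : laurentCoeff (fun _ => 1) m = if m = 0 then 1 else 0 := by
  simp only [laurentCoeff, mul_one]
  split_ifs with h
  · have := circleIntegral.integral_sub_center_inv (0 : ℂ) one_ne_zero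
    simp only [sub_zero] at this
    simp only [h, neg_zero, zero_sub, zpow_neg_one, this]
    exact inv_mul_cancel₀ Complex.two_pi_I_ne_zero
  · have := circleIntegral.integral_sub_zpow_of_ne (n := -m - 1) (by omega) 0 0 1
    simp only [sub_zero] at this
    rw [this, mul_zero]

theorem laurentCoeff_const_mul_zpow (c : ℂ) (e m : ℤ) :
    laurentCoeff (fun z => c * z ^ e) m = if e = m then c else 0 := by
  have h := laurentCoeff_const_mul_zpow_mul c e (fun _ => 1) m
  simpa only [mul_one, laurentCoeff_one, sub_eq_zero, mul_ite, mul_zero, eq_comm (a := m)] using h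

theorem hasSum_laurentCoeff {ι : Type*} [Countable ι] {f : ι → ℂ → ℂ} {u : ι → ℝ}
    (hf : ∀ i, ContinuousOn (f i) (Metric.sphere 0 1)) (hu : Summable u)
    (hfu : ∀ i z, ‖z‖ = 1 → ‖f i z‖ ≤ u i) (m : ℤ) :
    HasSum (fun i => laurentCoeff (f i) m) (laurentCoeff (fun z => ∑' i, f i z) m) := by
  have norm_circleMap (θ : ℝ) : ‖circleMap 0 1 θ‖ = 1 := by simp
  refine HasSum.mul_left _ (intervalIntegral.hasSum_integral_of_dominated_convergence
    (fun i _ => u i) (fun i => ?_) (fun i => .of_forall fun θ _ => ?_)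
    (.of_forall fun _ _ => hu) intervalIntegrable_const (.of_forall fun θ _ => ?_))
  · exact (circleIntegrable_zpow_mul (hf i) _).out.aestronglyMeasurable_restrict_uIoc
  · simpa [norm_smul, norm_mul, norm_zpow, norm_circleMap] using hfu i _ (norm_circleMap θ)
  · have := Summable.of_norm_bounded hu fun i => hfu i _ (norm_circleMap θ)
    simpa only [smul_eq_mul] using (this.hasSum.mul_left _).mul_left _

end Laurent

section WeylTermLaurent

variable {q : ℂ}

theorem continuousOn_weylTerm (N : ℕ) (q : ℂ) (j : ℤ) :
    ContinuousOn (fun z => weylTerm N q z j) (Metric.sphere 0 1) :=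
  ((continuousOn_zpow_unit_sphere _).mul continuousOn_const).mul
    (continuousOn_const.sub (continuousOn_id.mul continuousOn_const))

theorem norm_weylTerm_le (N : ℕ) (q : ℂ) {z : ℂ} (hz : ‖z‖ = 1) (j : ℤ) :
    ‖weylTerm N q z j‖ ≤ ‖weylTerm N ‖q‖ (-1) j‖ := by
  have factor_le : ‖1 - z * q ^ (2 * j)‖ ≤ ‖1 - -1 * (‖q‖ : ℂ) ^ (2 * j)‖ := by
    have h : 0 ≤ 1 + ‖q‖ ^ (2 * j) := by positivity
    calc ‖1 - z * q ^ (2 * j)‖ ≤ 1 + ‖q‖ ^ (2 * j) := by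
          simpa [hz] using norm_sub_le 1 (z * q ^ (2 * j))
      _ = ‖1 - -1 * (‖q‖ : ℂ) ^ (2 * j)‖ := by
          rw [neg_one_mul, sub_neg_eq_add, ← Real.norm_of_nonneg h, ← Complex.norm_real]
          push_cast
          rfl
  simp only [weylTerm, norm_mul, norm_zpow, hz, norm_neg, norm_one, one_zpow, Complex.norm_real,
    norm_norm]
  gcongr

theorem laurentCoeff_weylTerm (hq0 : q ≠ 0) (N : ℕ) (j m : ℤ) :
    laurentCoeff (fun z => weylTerm N q z j) m =
      (if (N + 2) * j = m then q ^ ((N + 2) * j ^ 2 - j) else 0) -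
        if (N + 2) * j + 1 = m then q ^ ((N + 2) * j ^ 2 + j) else 0 := by
  rw [← laurentCoeff_const_mul_zpow, ← laurentCoeff_const_mul_zpow, ← laurentCoeff_sub
    (continuousOn_const.fun_mul (continuousOn_zpow_unit_sphere _))
    (continuousOn_const.fun_mul (continuousOn_zpow_unit_sphere _))]
  refine laurentCoeff_congr (fun z hz => ?_) m
  have hz0 : z ≠ 0 := norm_ne_zero_iff.mp (hz.trans_ne one_ne_zero)
  rw [weylTerm, zpow_add_one₀ hz0,
    show (N + 2) * j ^ 2 + j = ((N + 2) * j ^ 2 - j) + 2 * j by ring, zpow_add₀ hq0 _ (2 * j)]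
  ring

theorem summable_norm_weylTerm_norm (hq : ‖q‖ < 1) (hq0 : q ≠ 0) (N : ℕ) :
    Summable fun j => ‖weylTerm N ‖q‖ (-1) j‖ :=
  (summable_weylTerm (by simpa using hq) (by simpa using hq0) (by norm_num) N).norm

theorem hasSum_laurentCoeff_weylTerm (hq : ‖q‖ < 1) (hq0 : q ≠ 0) (N : ℕ) (m : ℤ) :
    HasSum (fun j => laurentCoeff (fun z => weylTerm N q z j) m)
      (laurentCoeff (fun z => ∑' j, weylTerm N q z j) m) :=
  hasSum_laurentCoeff (continuousOn_weylTerm N q) (summable_norm_weylTerm_norm hq hq0 N)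
    (fun j _ hz => norm_weylTerm_le N q hz j) m

theorem laurentCoeff_tsum_weylTerm_one (hq : ‖q‖ < 1) (hq0 : q ≠ 0) (N : ℕ) :
    laurentCoeff (fun z => ∑' j, weylTerm N q z j) 1 = -1 := by
  refine (hasSum_laurentCoeff_weylTerm hq hq0 N 1).unique ?_
  have no_solution (j : ℤ) : (N + 2) * j ≠ 1 := fun h => by
    have := Int.le_of_dvd one_pos ⟨j, h.symm⟩
    omega
  have level_pos : (N + 2 : ℤ) ≠ 0 := by positivity
  convert hasSum_ite_eq (0 : ℤ) (-1 : ℂ) using 2 with j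
  rw [laurentCoeff_weylTerm hq0, if_neg (no_solution j)]
  by_cases hj : j = 0 <;> simp [hj, level_pos]

/-- The two monomials of a level-zero `weylTerm` contribute the even and the odd powers of `z`. -/
theorem laurentCoeff_tsum_weylTerm_zero (hq : ‖q‖ < 1) (hq0 : q ≠ 0) (m : ℤ) :
    laurentCoeff (fun z => ∑' j, weylTerm 0 q z j) m = (-1) ^ m * q ^ (m * (m - 1) / 2) := by
  refine (hasSum_laurentCoeff_weylTerm hq hq0 0 m).unique ?_
  simp only [laurentCoeff_weylTerm hq0, Nat.cast_zero, zero_add]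
  obtain ⟨k, rfl | rfl⟩ := Int.even_or_odd' m
  · convert hasSum_ite_eq k (q ^ (2 * k ^ 2 - k)) using 2 with j
    · simp only [mul_right_inj' (two_ne_zero' ℤ), show 2 * j + 1 ≠ 2 * k by omega, if_false,
        sub_zero]
      split_ifs with h
      · rw [h]
      · rfl
    · rw [(even_two_mul k).neg_one_zpow, one_mul, mul_assoc,
        Int.mul_ediv_cancel_left _ two_ne_zero]
      ring_nf
  · convert hasSum_ite_eq k (-q ^ (2 * k ^ 2 + k)) using 2 with j
    · simp only [add_left_inj, mul_right_inj' (two_ne_zero' ℤ),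
        show 2 * j ≠ 2 * k + 1 by omega, if_false, zero_sub]
      split_ifs with h
      · rw [h]
      · rw [neg_zero]
    · rw [(odd_two_mul_add_one k).neg_one_zpow, neg_one_mul, add_sub_cancel_right, mul_left_comm,
        Int.mul_ediv_cancel_left _ two_ne_zero]
      ring_nf

theorem laurentCoeff_chainTerm_mul_theta (hq : ‖q‖ < 1) (hq0 : q ≠ 0) (c : ℂ) (s : ℤ) :
    laurentCoeff (fun z => c * z ^ s * ∑' j, weylTerm 0 q z j) 1 =
      -((-1) ^ s * q ^ (s * (s - 1) / 2) * c) := by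
  rw [laurentCoeff_const_mul_zpow_mul, laurentCoeff_tsum_weylTerm_zero hq hq0,
    zpow_sub₀ (by norm_num), zpow_one, neg_div, one_div, ← inv_zpow, inv_neg_one,
    show (1 - s) * (1 - s - 1) = s * (s - 1) by ring]
  ring

theorem continuousOn_tsum_weylTerm (hq : ‖q‖ < 1) (hq0 : q ≠ 0) (N : ℕ) :
    ContinuousOn (fun z => ∑' j, weylTerm N q z j) (Metric.sphere 0 1) :=
  continuousOn_tsum (continuousOn_weylTerm N q) (summable_norm_weylTerm_norm hq hq0 N)
    fun j _ hz => norm_weylTerm_le N q (mem_sphere_zero_iff_norm.mp hz) j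

theorem norm_tsum_weylTerm_le (hq : ‖q‖ < 1) (hq0 : q ≠ 0) (N : ℕ) {z : ℂ} (hz : ‖z‖ = 1) :
    ‖∑' j, weylTerm N q z j‖ ≤ ∑' j, ‖weylTerm N ‖q‖ (-1) j‖ :=
  tsum_of_norm_bounded (summable_norm_weylTerm_norm hq hq0 N).hasSum fun j =>
    norm_weylTerm_le N q hz j

theorem hasSum_chainTerm (hq : ‖q‖ < 1) (hq0 : q ≠ 0) (n : ℕ) :
    HasSum (fun p : ℤ × (Fin n → ℕ) =>
      (-1 : ℂ) ^ (∑ i, chain p.1 p.2 i) *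
        q ^ ((∑ i, chain p.1 p.2 i) * (∑ i, chain p.1 p.2 i - 1) / 2) * chainTerm q p.1 p.2)
      (qPochInf q q) := by
  have summable_bound := (summable_norm_chainTerm hq hq0 one_ne_zero n).mul_right
    (∑' j, ‖weylTerm 0 ‖q‖ (-1) j‖)
  simp only [one_zpow, one_mul] at summable_bound
  have expansion := hasSum_laurentCoeff (f := fun (p : ℤ × (Fin n → ℕ)) z =>
      chainTerm q p.1 p.2 * z ^ (∑ i, chain p.1 p.2 i) * ∑' j, weylTerm 0 q z j)
    (fun p => (continuousOn_const.mul (continuousOn_zpow_unit_sphere _)).mul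
      (continuousOn_tsum_weylTerm hq hq0 0)) summable_bound
    (fun p z hz => by
      rw [norm_mul, norm_mul, norm_zpow, hz, one_zpow, mul_one]
      gcongr
      exact norm_tsum_weylTerm_le hq hq0 0 hz) 1
  have total : laurentCoeff (fun z => ∑' p : ℤ × (Fin n → ℕ),
      chainTerm q p.1 p.2 * z ^ (∑ i, chain p.1 p.2 i) * ∑' j, weylTerm 0 q z j) 1 =
        -qPochInf q q := by
    have h := laurentCoeff_const_mul_zpow_mul (qPochInf q q) 0
      (fun z => ∑' j, weylTerm (n + 1) q z j) 1
    rw [sub_zero, laurentCoeff_tsum_weylTerm_one hq hq0, mul_neg_one] at h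
    rw [← h]
    refine laurentCoeff_congr (fun z hz => ?_) 1
    rw [zpow_zero, mul_one, ← tsum_weylTerm_zero_mul_tsum_chainTerm hq hq0
      (norm_ne_zero_iff.mp (hz.trans_ne one_ne_zero)), tsum_mul_right, mul_comm]
    simp only [mul_comm]
  simpa only [laurentCoeff_chainTerm_mul_theta hq hq0, total, neg_neg] using expansion.neg

end WeylTermLaurent

section Cartan

variable {n : ℕ}

/-- The matrix whose rows are the simple roots `e_l - e_{l+1}` of `A_n`, as vectors of `ℚ ^ (n + 1)`
(the ambient space of the root system). -/
def simpleRoots (n : ℕ) : Matrix (Fin n) (Fin (n + 1)) ℚ :=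
  .of fun l => Pi.single l.castSucc 1 - Pi.single l.succ 1

theorem simpleRoots_mulVec (a : Fin (n + 1) → ℚ) (l : Fin n) :
    (simpleRoots n *ᵥ a) l = a l.castSucc - a l.succ := by
  change (Pi.single l.castSucc 1 - Pi.single l.succ 1) ⬝ᵥ a = _
  rw [sub_dotProduct, single_one_dotProduct, single_one_dotProduct]

theorem cartan_eq_simpleRoots_mul_transpose (n : ℕ) :
    cartan (n + 1) = simpleRoots n * (simpleRoots n)ᵀ := by
  ext l m
  have entry : (simpleRoots n * (simpleRoots n)ᵀ) l m =
      simpleRoots n m l.castSucc - simpleRoots n m l.succ := simpleRoots_mulVec (simpleRoots n m) l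
  rw [entry]
  simp only [cartan, CartanMatrix.A, simpleRoots, Matrix.map_apply, Matrix.of_apply, Pi.sub_apply,
    Pi.single_apply, Fin.ext_iff, Fin.val_castSucc, Fin.val_succ]
  split_ifs <;> first | omega | norm_num

theorem simpleRoots_mulVec_surjective (n : ℕ) : Function.Surjective (simpleRoots n).mulVec :=
  fun y => ⟨-Fin.partialSum y, funext fun l => by
    rw [simpleRoots_mulVec, Pi.neg_apply, Pi.neg_apply, Fin.partialSum_succ]
    ring⟩

theorem eq_apply_zero_of_simpleRoots_mulVec_eq_zero {a : Fin (n + 1) → ℚ}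
    (ha : simpleRoots n *ᵥ a = 0) (i : Fin (n + 1)) : a i = a 0 := by
  induction i using Fin.induction with
  | zero => rfl
  | succ l ih =>
    have := congrFun ha l
    rw [simpleRoots_mulVec, Pi.zero_apply] at this
    linarith

theorem sum_vecMul_simpleRoots (x : Fin n → ℚ) : ∑ i, (x ᵥ* simpleRoots n) i = 0 := by
  have : simpleRoots n *ᵥ 1 = 0 := funext fun l => by simp [simpleRoots_mulVec]
  rw [← dotProduct_one, ← Matrix.dotProduct_mulVec, this, dotProduct_zero]

theorem cartan_mulVec (x : Fin n → ℚ) :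
    cartan (n + 1) *ᵥ x = simpleRoots n *ᵥ (x ᵥ* simpleRoots n) := by
  rw [cartan_eq_simpleRoots_mul_transpose, ← Matrix.mulVec_mulVec, Matrix.mulVec_transpose]

theorem isUnit_cartan (n : ℕ) : IsUnit (cartan (n + 1)) := by
  refine Matrix.mulVec_injective_iff_isUnit.mp ((injective_iff_map_eq_zero
    (cartan (n + 1)).mulVecLin).mpr fun (x : Fin n → ℚ) hx => ?_)
  have vecMul_eq_zero : x ᵥ* simpleRoots n = 0 := by
    rw [← dotProduct_self_eq_zero, ← Matrix.dotProduct_mulVec, ← cartan_mulVec]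
    exact (congrArg (x ⬝ᵥ ·) hx).trans (dotProduct_zero x)
  obtain ⟨a, ha⟩ := simpleRoots_mulVec_surjective n x
  rw [← dotProduct_self_eq_zero]
  nth_rw 2 [← ha]
  rw [Matrix.dotProduct_mulVec, vecMul_eq_zero, zero_dotProduct]

theorem inv_cartan_mulVec_vecMul_simpleRoots (a : Fin (n + 1) → ℚ) :
    ((cartan (n + 1))⁻¹ *ᵥ (simpleRoots n *ᵥ a)) ᵥ* simpleRoots n =
      fun i => a i - (∑ k, a k) / (n + 1) := by
  set b := ((cartan (n + 1))⁻¹ *ᵥ (simpleRoots n *ᵥ a)) ᵥ* simpleRoots n with hb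
  have same_image : simpleRoots n *ᵥ b = simpleRoots n *ᵥ a := by
    rw [hb, ← cartan_mulVec, Matrix.mulVec_mulVec, Matrix.mul_nonsing_inv _
      ((Matrix.isUnit_iff_isUnit_det _).mp (isUnit_cartan n)), Matrix.one_mulVec]
  have shift (i : Fin (n + 1)) : a i - b i = a 0 - b 0 :=
    eq_apply_zero_of_simpleRoots_mulVec_eq_zero (a := a - b)
      (by rw [Matrix.mulVec_sub, same_image, sub_self]) i
  have mean : ∑ k, a k = (n + 1) * (a 0 - b 0) := by
    have h : ∑ k, (a k - b k) = ∑ k, a k := by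
      rw [Finset.sum_sub_distrib, hb, sum_vecMul_simpleRoots, sub_zero]
    rw [← h, Finset.sum_congr rfl fun k _ => shift k, Fin.sum_const, nsmul_eq_mul]
    push_cast
    rfl
  funext i
  rw [mean, mul_div_cancel_left₀ _ (by positivity), ← shift i, sub_sub_cancel]

theorem ratVec_eq_simpleRoots_mulVec_chain (r : ℤ) (η : Fin n → ℕ) :
    ratVec (N := n + 1) η = simpleRoots n *ᵥ fun i => (chain r η i : ℚ) := by
  funext l
  rw [simpleRoots_mulVec, ratVec]
  exact_mod_cast (chain_castSucc_sub_succ r η l).symm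

theorem unitVec_one_eq_simpleRoots_mulVec (n : ℕ) :
    unitVec (n + 1) 1 = simpleRoots n *ᵥ Pi.single 0 1 := by
  funext l
  simp [unitVec, simpleRoots_mulVec, Pi.single_apply, Fin.ext_iff]

theorem firstEntry_eq_sub (r : ℤ) (η : Fin n → ℕ) :
    firstEntry (N := n + 1) η = r - (∑ i, chain r η i : ℤ) / (n + 1) := by
  rw [firstEntry, ratVec_eq_simpleRoots_mulVec_chain r, unitVec_one_eq_simpleRoots_mulVec,
    dotProduct_comm, Matrix.dotProduct_mulVec, inv_cartan_mulVec_vecMul_simpleRoots,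
    dotProduct_single_one, chain_zero]
  push_cast
  rfl

theorem quadForm_eq_sub (r : ℤ) (η : Fin n → ℕ) :
    quadForm (N := n + 1) η =
      (∑ i, chain r η i ^ 2 : ℤ) - (∑ i, chain r η i : ℤ) ^ 2 / (n + 1) := by
  rw [quadForm, ratVec_eq_simpleRoots_mulVec_chain r, dotProduct_comm, Matrix.dotProduct_mulVec,
    inv_cartan_mulVec_vecMul_simpleRoots]
  simp only [dotProduct, sub_mul, Finset.sum_sub_distrib, ← Finset.mul_sum]
  push_cast
  ring_nf

end Cartan

section Assembly

variable {n : ℕ} {q w : ℂ}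

theorem neg_sum_chain_admissible (r : ℤ) (η : Fin n → ℕ) :
    η ∈ Admissible (n + 1) (-∑ i, chain r η i) := by
  refine ⟨-r, ?_⟩
  rw [firstEntry_eq_sub r η]
  push_cast
  ring

/-- The chain with first entry `r` and successive differences `η`, sorted by the negative `j` of its
sum; the first entry can be recovered from `j` and `η`. -/
def chainSigma (p : ℤ × (Fin n → ℕ)) : Σ j : ℤ, Admissible (n + 1) j :=
  ⟨-∑ i, chain p.1 p.2 i, p.2, neg_sum_chain_admissible p.1 p.2⟩

theorem chainSigma_injective : Function.Injective (chainSigma (n := n)) := by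
  rintro ⟨r, η⟩ ⟨r', η'⟩ h
  obtain rfl : η = η' := congrArg (fun x : Σ j : ℤ, Admissible (n + 1) j => x.2.1) h
  have sum_eq : ∑ i, chain r η i = ∑ i, chain r' η i := neg_inj.mp (congrArg Sigma.fst h)
  have first_eq := (firstEntry_eq_sub r η).symm.trans (firstEntry_eq_sub r' η)
  rw [sum_eq, sub_left_inj] at first_eq
  exact Prod.ext (Int.cast_injective first_eq) rfl

theorem chainSigma_surjective : Function.Surjective (chainSigma (n := n)) := by
  rintro ⟨j, η, m, hm⟩
  obtain rfl : -∑ i, chain (-m) η i = j := by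
    rw [firstEntry_eq_sub (-m) η, ← sub_eq_zero] at hm
    push_cast at hm
    have hN : (n : ℚ) + 1 ≠ 0 := by positivity
    field_simp at hm
    have : ((-∑ i, chain (-m) η i : ℤ) : ℚ) = j := by
      push_cast
      linarith
    exact_mod_cast this
  exact ⟨(-m, η), rfl⟩

theorem qPow_intCast (hw : Complex.exp w = q) (k : ℤ) : qPow w k = q ^ k := by
  rw [qPow, Rat.cast_intCast, Complex.exp_int_mul, hw]

theorem qPow_add (w : ℂ) (s t : ℚ) : qPow w (s + t) = qPow w s * qPow w t := by
  rw [qPow, Rat.cast_add, add_mul, Complex.exp_add, qPow, qPow]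

/-- The factor in front of the inner sum in `outerTerm`. -/
noncomputable def outerFactor (N : ℕ) (w : ℂ) (j : ℤ) : ℂ :=
  (-1 : ℂ) ^ j * qPow w (((1 + 2 / (N : ℚ)) * (j : ℚ) + 1) * (j : ℚ) / 2)

theorem outerFactor_ne_zero (N : ℕ) (w : ℂ) (j : ℤ) : outerFactor N w j ≠ 0 :=
  mul_ne_zero (zpow_ne_zero _ (by norm_num)) (Complex.exp_ne_zero _)

theorem outer_exponent_add_quadForm (r : ℤ) (η : Fin n → ℕ) :
    ((1 + 2 / ((n + 1 : ℕ) : ℚ)) * (-∑ i, chain r η i : ℤ) + 1) * (-∑ i, chain r η i : ℤ) / 2 +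
        quadForm (N := n + 1) η =
      ((∑ i, chain r η i) * (∑ i, chain r η i - 1) / 2 + ∑ i, chain r η i ^ 2 : ℤ) := by
  rw [quadForm_eq_sub r η]
  set s := ∑ i, chain r η i
  have even : (2 : ℤ) ∣ s * (s - 1) := (Int.even_mul_pred_self s).two_dvd
  have hN : (n : ℚ) + 1 ≠ 0 := by positivity
  rw [Int.cast_add, Int.cast_div even two_ne_zero]
  push_cast
  field_simp
  ring

theorem outerFactor_mul_innerTerm (hq0 : q ≠ 0) (hw : Complex.exp w = q) (r : ℤ) (η : Fin n → ℕ) :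
    outerFactor (n + 1) w (-∑ i, chain r η i) * innerTerm (N := n + 1) q w η =
      (-1 : ℂ) ^ (∑ i, chain r η i) *
        q ^ ((∑ i, chain r η i) * (∑ i, chain r η i - 1) / 2) * chainTerm q r η := by
  rw [outerFactor, innerTerm, chainTerm, ← mul_div_assoc, ← mul_div_assoc, mul_assoc, mul_assoc,
    ← qPow_add, outer_exponent_add_quadForm, qPow_intCast hw, zpow_add₀ hq0, zpow_neg, ← inv_zpow,
    inv_neg_one]
  rfl

theorem hasSum_outerFactor_mul_innerTerm (hq : ‖q‖ < 1) (hw : Complex.exp w = q) (n : ℕ) :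
    HasSum (fun x : Σ j : ℤ, Admissible (n + 1) j =>
      outerFactor (n + 1) w x.1 * innerTerm q w (x.2 : Fin (n + 1 - 1) → ℕ)) (qPochInf q q) := by
  have hq0 : q ≠ 0 := hw ▸ Complex.exp_ne_zero w
  rw [← (Equiv.ofBijective _ ⟨chainSigma_injective, chainSigma_surjective⟩).hasSum_iff]
  exact (hasSum_chainTerm hq hq0 n).congr_fun fun p => outerFactor_mul_innerTerm hq0 hw p.1 p.2

theorem summable_innerTerm (hq : ‖q‖ < 1) (hw : Complex.exp w = q) (n : ℕ) (j : ℤ) :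
    Summable fun η : Admissible (n + 1) j => innerTerm q w (η : Fin (n + 1 - 1) → ℕ) :=
  (summable_mul_left_iff (outerFactor_ne_zero (n + 1) w j)).mp
    ((hasSum_outerFactor_mul_innerTerm hq hw n).summable.sigma_factor j)

theorem hasSum_outerTerm (hq : ‖q‖ < 1) (hw : Complex.exp w = q) (n : ℕ) :
    HasSum (outerTerm (n + 1) q w) (qPochInf q q) :=
  (hasSum_outerFactor_mul_innerTerm hq hw n).sigma fun j =>
    (summable_innerTerm hq hw n j).hasSum.mul_left (outerFactor (n + 1) w j)

end Assembly

end GenEuler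

theorem mainTheorem4 (N : ℕ) (hN : 1 ≤ N) (q w : ℂ) (hq : ‖q‖ < 1) (hw : Complex.exp w = q) :
    Multipliable (fun i : ℕ => 1 - q * q ^ i) ∧
    (∀ j : ℤ, Summable
      (fun η : GenEuler.Admissible N j => GenEuler.innerTerm q w (η : Fin (N - 1) → ℕ))) ∧
    Summable (GenEuler.outerTerm N q w) ∧
    1 / GenEuler.qPochInf q q * ∑' j : ℤ, GenEuler.outerTerm N q w j = 1 := by
  obtain ⟨n, rfl⟩ := Nat.exists_eq_add_of_le' hN
  have hout := GenEuler.hasSum_outerTerm hq hw n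
  refine ⟨GenEuler.multipliable_one_sub_mul_pow hq q, GenEuler.summable_innerTerm hq hw n,
    hout.summable, ?_⟩
  rw [hout.tsum_eq, one_div_mul_cancel (GenEuler.qPochInf_self_ne_zero hq)]
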